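/- Let $X$ be a sequentially complete Hausdorff locally convex space over $\mathbb C$ and let $(T(t))_{t\geq 0}$ be a strongly continuous, locally equicontinuous semigroup of continuous linear operators on $X$; that is, $T(0)=\mathrm{id}$, $T(t+s)=T(t)T(s)$ for all $t,s\ge 0$, the map $[0,\infty)\to X$, $t\mapsto T(t)x$, is continuous for every $x\in X$, and for every continuous seminorm $q$ on $X$ and every $t_0\ge 0$ there are a continuous seminorm $p$ on $X$ and $C\ge 0$ with $q(T(t)x)\le C\,p(x)$ for all $t\in[0,t_0]$ and $x\in X$. Let $(A,D(A))$ be its generator, i.e. $D(A)$ is the set of all $x\in X$ for which $Ax:=\lim_{t\to 0+}\frac{T(t)x-x}{t}$ exists in $X$. Let $\rho(A)$ be the set of all $\lambda\in\mathbb C$ such that $\lambda-A\colon D(A)\to X$ is bijective and $R(\lambda,A):=(\lambda-A)^{-1}$ is a continuous linear operator on $X$. Let $\rho^*(A)$ be the set of all $\lambda\in\rho(A)$ for which there is $\delta>0$ such that $B(\lambda,\delta):=\{\mu\in\mathbb C : |\mu-\lambda|<\delta\}\subseteq\rho(A)$ and $\{R(\mu,A) : \mu\in B(\lambda,\delta)\}$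 is equicontinuous. Put $\sigma^*(A):=\mathbb C\setminus\rho^*(A)$ and $\sigma_p(A):=\{\lambda\in\mathbb C : \lambda-A\text{ is not injective}\}$. Then the following assertions are equivalent. (a) $(T(t))_{t\ge 0}$ is periodic, i.e. there is $t_0>0$ with $T(t_0)=\mathrm{id}$. (b) $\sigma^*(A)=\sigma_p(A)\subseteq 2\pi i\alpha\mathbb Z$ for some $\alpha>0$, and, if $X\neq\{0\}$, the corresponding eigenvectors, i.e. all nonzero $x\in D(A)$ with $Ax=\lambda x$ for some $\lambda\in\sigma_p(A)$, span a dense linear subspace of $X$. -/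

import Mathlib

open Filter Topology
open scoped NNReal

namespace LCSemigroup

section Definitions

variable {X : Type*} [AddCommGroup X] [Module ℂ X]

/-- Sequential completeness: every Cauchy sequence converges. -/
def IsSeqComplete (Y : Type*) [UniformSpace Y] : Prop :=
  ∀ u : ℕ → Y, CauchySeq u → ∃ y : Y, Tendsto u atTop (𝓝 y)

/-! ### Linear operators `A : D(A) ⊆ X → X` and their spectra -/

/-- The operator `μ - A : D(A) → X`. -/
def shift (A : X →ₗ.[ℂ] X) (μ : ℂ) : A.domain →ₗ[ℂ] X :=
  μ • A.domain.subtype - A.toFun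

/-- The point spectrum: all `μ` such that `μ - A` is not injective. -/
def pointSpectrum (A : X →ₗ.[ℂ] X) : Set ℂ :=
  {μ | ¬ Function.Injective (shift A μ)}

/-- The eigenvectors of `A`: nonzero `x ∈ D(A)` with `A x = μ x` for some `μ` in the
point spectrum. -/
def eigenvectors (A : X →ₗ.[ℂ] X) : Set X :=
  {x | x ≠ 0 ∧ ∃ μ ∈ pointSpectrum A, ∃ h : x ∈ A.domain, A ⟨x, h⟩ = μ • x}

/-- The resolvent set: all `μ` such that `μ - A : D(A) → X` is bijective and its inverse is
(given by) a continuous linear operator on `X`. -/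
def resolventSet [TopologicalSpace X] (A : X →ₗ.[ℂ] X) : Set ℂ :=
  {μ | Function.Bijective (shift A μ) ∧
    ∃ R : X →L[ℂ] X, ∀ x : A.domain, R (shift A μ x) = (x : X)}

/-- The resolvent `R(μ, A) = (μ - A)⁻¹` for `μ` in the resolvent set. -/
noncomputable def resolvent [TopologicalSpace X] (A : X →ₗ.[ℂ] X) (μ : resolventSet A) :
    X →L[ℂ] X :=
  Classical.choose μ.2.2

theorem resolvent_shift [TopologicalSpace X] (A : X →ₗ.[ℂ] X) (μ : resolventSet A)
    (x : A.domain) : resolvent A μ (shift A μ x) = (x : X) :=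
  Classical.choose_spec μ.2.2 x

/-- The set `ρ*(A)`: all `μ ∈ ρ(A)` such that some open ball `B(μ, δ)`, `δ > 0`, is contained
in `ρ(A)` and the resolvents `R(ν, A)`, `ν ∈ B(μ, δ)`, form an equicontinuous family. -/
def resolventSetStar [UniformSpace X] (A : X →ₗ.[ℂ] X) : Set ℂ :=
  {μ | μ ∈ resolventSet A ∧ ∃ δ : ℝ, 0 < δ ∧ ∃ h : Metric.ball μ δ ⊆ resolventSet A,
    Equicontinuous fun (ν : Metric.ball μ δ) (x : X) => resolvent A ⟨ν, h ν.2⟩ x}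

/-- The set `σ*(A) = ℂ \ ρ*(A)`. -/
def spectrumStar [UniformSpace X] (A : X →ₗ.[ℂ] X) : Set ℂ :=
  (resolventSetStar A)ᶜ

/-! ### One-parameter semigroups `(T(t))_{t ≥ 0}` of continuous linear operators -/

/-- The semigroup law. -/
structure IsSemigroup [TopologicalSpace X] (T : ℝ≥0 → X →L[ℂ] X) : Prop where
  map_zero : T 0 = ContinuousLinearMap.id ℂ X
  map_add : ∀ t s : ℝ≥0, T (t + s) = (T t).comp (T s)

/-- Strong continuity: `t ↦ T(t)` is continuous on `[0, ∞)` for the topology of pointwise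
convergence, i.e. all orbits are continuous. -/
def IsStronglyContinuous [TopologicalSpace X] (T : ℝ≥0 → X →L[ℂ] X) : Prop :=
  ∀ x : X, Continuous fun t : ℝ≥0 => T t x

/-- Local equicontinuity, with respect to the fundamental system of all continuous seminorms. -/
def IsLocallyEquicontinuous [TopologicalSpace X] (T : ℝ≥0 → X →L[ℂ] X) : Prop :=
  ∀ q : Seminorm ℂ X, Continuous q → ∀ t₀ : ℝ≥0,
    ∃ p : Seminorm ℂ X, Continuous p ∧ ∃ C : ℝ≥0,
      ∀ t ≤ t₀, ∀ x : X, q (T t x) ≤ C * p x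

/-- Periodicity: `T(t₀) = id` for some `t₀ > 0`. -/
def IsPeriodic [TopologicalSpace X] (T : ℝ≥0 → X →L[ℂ] X) : Prop :=
  ∃ t₀ : ℝ≥0, 0 < t₀ ∧ T t₀ = ContinuousLinearMap.id ℂ X

/-- `y` is the limit of `(T(t) x - x) / t` as `t → 0+`. -/
def HasGeneratorAt [TopologicalSpace X] (T : ℝ≥0 → X →L[ℂ] X) (x y : X) : Prop :=
  Tendsto (fun t : ℝ≥0 => ((t : ℝ) : ℂ)⁻¹ • (T t x - x)) (𝓝[>] 0) (𝓝 y)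

section Generator

variable [TopologicalSpace X] {T : ℝ≥0 → X →L[ℂ] X}

theorem HasGeneratorAt.zero : HasGeneratorAt T 0 0 := by
  simpa [HasGeneratorAt] using tendsto_const_nhds

theorem HasGeneratorAt.add [IsTopologicalAddGroup X] {x x' y y' : X}
    (h : HasGeneratorAt T x y) (h' : HasGeneratorAt T x' y') :
    HasGeneratorAt T (x + x') (y + y') := by
  refine (Tendsto.add h h').congr fun t => ?_
  rw [← smul_add, map_add]
  congr 1
  abel

theorem HasGeneratorAt.smul [ContinuousSMul ℂ X] {x y : X} (c : ℂ)
    (h : HasGeneratorAt T x y) : HasGeneratorAt T (c • x) (c • y) := by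
  refine (Tendsto.const_smul h c).congr fun t => ?_
  rw [map_smul, ← smul_sub, smul_comm]

theorem HasGeneratorAt.unique [T2Space X] {x y y' : X} (h : HasGeneratorAt T x y)
    (h' : HasGeneratorAt T x y') : y = y' :=
  tendsto_nhds_unique h h'

variable [IsTopologicalAddGroup X] [ContinuousSMul ℂ X]

/-- The generator `(A, D(A))`: `D(A)` is the set of all `x` for which
`lim_{t → 0+} (T(t) x - x) / t` exists in `X`, and `A x` is this limit. -/
noncomputable def generator [T2Space X] (T : ℝ≥0 → X →L[ℂ] X) : X →ₗ.[ℂ] X where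
  domain :=
    { carrier := {x | ∃ y, HasGeneratorAt T x y}
      zero_mem' := ⟨0, HasGeneratorAt.zero⟩
      add_mem' := fun ⟨_, h⟩ ⟨_, h'⟩ => ⟨_, h.add h'⟩
      smul_mem' := fun c _ ⟨_, h⟩ => ⟨_, h.smul c⟩ }
  toFun :=
    { toFun := fun x => Classical.choose x.2
      map_add' := fun x x' => HasGeneratorAt.unique (Classical.choose_spec (x + x').2)
        ((Classical.choose_spec x.2).add (Classical.choose_spec x'.2))
      map_smul' := fun c x => HasGeneratorAt.unique (Classical.choose_spec (c • x).2)
        ((Classical.choose_spec x.2).smul c) }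

theorem mem_generator_domain [T2Space X] {x : X} :
    x ∈ (generator T).domain ↔ ∃ y, HasGeneratorAt T x y :=
  Iff.rfl

theorem hasGeneratorAt_generator [T2Space X] (x : (generator T).domain) :
    HasGeneratorAt T x (generator T x) :=
  Classical.choose_spec x.2

end Generator

end Definitions

end LCSemigroup

/-! If `x` is an eigenvector for `μ`, then `T(t)x = e^{μt}x`. When all eigenvalues lie in `2πiαℤ`,
`T(1/α)` fixes every eigenvector, hence all of `X` by density and continuity.

Conversely let `T(p) = id` and `y = ∫₀ᵖ e^{-μs} T(s)x ds`. Shifting the window of integration and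
using periodicity gives `Ay = μy + (e^{-μp} - 1)x`, which settles everything. If `e^{-μp} ≠ 1`,
dividing by `1 - e^{-μp}` gives the resolvent, with bounds locally uniform in `μ`. If `e^{-μp} = 1`,
then `y` is zero or an eigenvector. When `μ` is not an eigenvalue, `y = 0` for every `x`; so
`e^{-μs}` may be subtracted from the kernel at nearby `ν`, which cancels the pole of `(1 -
e^{-νp})⁻¹` and leaves uniformly bounded kernels (`mem_resolventSetStar_of_exp_eq_one`). Hence `σ* =
σ_p`. Density: a functional vanishing on all eigenvectors annihilates every Fourier coefficient of
each orbit, so it is zero (`dense_span_eigenvectors`).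

Integrals are taken weakly. Sequential completeness supplies them as limits of Riemann sums, and
Hahn-Banach turns scalar estimates into seminorm estimates. -/

namespace LCSemigroup

/-! ### Seminorms, duality and weak integrals -/

section WeakIntegral

open scoped ComplexOrder in
-- In the order on `𝕜`, the nonnegative elements are exactly the nonnegative reals, so real
-- convexity is `𝕜`-convexity; gauges then provide the seminorms.
theorem polynormableSpace_of_real (𝕜 : Type*) {X : Type*} [RCLike 𝕜] [AddCommGroup X] [Module 𝕜 X]
    [Module ℝ X] [IsScalarTower ℝ 𝕜 X] [TopologicalSpace X] [IsTopologicalAddGroup X]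
    [ContinuousSMul 𝕜 X] [LocallyConvexSpace ℝ X] : PolynormableSpace 𝕜 X := by
  have := IsScalarTower.continuousSMul (M := ℝ) (α := X) 𝕜
  have : LocallyConvexSpace 𝕜 X := by
    refine (locallyConvexSpace_iff_exists_convex_subset_zero 𝕜 X).2 fun U hU => ?_
    obtain ⟨S, hS, hSc, hSU⟩ :=
      (locallyConvexSpace_iff_exists_convex_subset_zero ℝ X).1 inferInstance U hU
    exact ⟨S, hS, convex_of_nonneg_surjective_algebraMap _
      (fun _ => RCLike.nonneg_iff_exists_ofReal.mp) hSc, hSU⟩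
  exact with_gaugeSeminormFamily.toPolynormableSpace

theorem polynormableSpace_complex {X : Type*} [AddCommGroup X] [Module ℂ X] [TopologicalSpace X]
    [IsTopologicalAddGroup X] [ContinuousSMul ℂ X] [LocallyConvexSpace ℝ X] :
    PolynormableSpace ℂ X :=
  polynormableSpace_of_real ℂ

variable {X : Type*} [AddCommGroup X] [Module ℂ X]

theorem exists_seminorm_ball_subset [TopologicalSpace X] [PolynormableSpace ℂ X] {U : Set X}
    (hU : U ∈ 𝓝 (0 : X)) :
    ∃ q : Seminorm ℂ X, Continuous q ∧ ∃ r : ℝ, 0 < r ∧ ∀ x, q x < r → x ∈ U := by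
  obtain ⟨⟨s, r⟩, hr, hsub⟩ := (PolynormableSpace.withSeminorms ℂ X).hasBasis_zero_ball.mem_iff.1 hU
  have := (PolynormableSpace.withSeminorms ℂ X).topologicalAddGroup
  refine ⟨s.sup fun p => p.1, Seminorm.continuous_finsetSup (fun (i : {p : Seminorm ℂ X // Continuous p}) _ => i.2), r, hr, fun x hx => hsub ?_⟩
  simpa [Seminorm.mem_ball_zero] using hx

theorem tendsto_of_seminorm [TopologicalSpace X] [PolynormableSpace ℂ X] {ι : Type*}
    {l : Filter ι} {f : ι → X} {y : X}
    (h : ∀ q : Seminorm ℂ X, Continuous q → ∀ ε > 0, ∀ᶠ i in l, q (f i - y) < ε) :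
    Tendsto f l (𝓝 y) := by
  have := (PolynormableSpace.withSeminorms ℂ X).topologicalAddGroup
  rw [← tendsto_sub_nhds_zero_iff]
  intro U hU
  obtain ⟨q, hq, r, hr, hU⟩ := exists_seminorm_ball_subset hU
  exact (h q hq r hr).mono fun i hi => hU _ hi

/-- Hahn-Banach: the functional `c • y ↦ c * q y` on the line through `y` is dominated by `q`, so it
extends with the same domination. -/
theorem exists_dual_eq_seminorm [TopologicalSpace X] [PolynormableSpace ℂ X] (q : Seminorm ℂ X)
    (hq : Continuous q) (y : X) :
    ∃ φ : X →L[ℂ] ℂ, (∀ x, ‖φ x‖ ≤ q x) ∧ φ y = q y := by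
  by_cases hy : y = 0
  · exact ⟨0, fun x => by simp, by simp [hy]⟩
  let e := LinearEquiv.toSpanNonzeroSingleton ℂ X y hy
  let f : Module.Dual ℂ (Submodule.span ℂ {y}) := (q y : ℂ) • e.symm.toLinearMap
  have he : ∀ c : ℂ, (e c : X) = c • y := fun c => rfl
  obtain ⟨φ, hφ, hle⟩ := f.exists_continuous_extension_of_le_seminorm _ hq (fun x => by
    obtain ⟨c, rfl⟩ := e.surjective x
    simp only [f, LinearMap.smul_apply, LinearEquiv.coe_coe, LinearEquiv.symm_apply_apply,
      norm_smul, he, map_smul_eq_mul, Complex.norm_real, Real.norm_eq_abs,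
      abs_of_nonneg (apply_nonneg q y)]
    rw [mul_comm])
  refine ⟨φ, hle, ?_⟩
  have h1 := hφ (e 1)
  simpa [f, he] using h1

theorem seminorm_le_of_dual [TopologicalSpace X] [PolynormableSpace ℂ X] {q : Seminorm ℂ X}
    (hq : Continuous q) {y : X} {C : ℝ}
    (h : ∀ φ : X →L[ℂ] ℂ, (∀ x, ‖φ x‖ ≤ q x) → ‖φ y‖ ≤ C) : q y ≤ C := by
  obtain ⟨φ, hle, hy⟩ := exists_dual_eq_seminorm q hq y
  have := h φ hle
  rw [hy, Complex.norm_real, Real.norm_eq_abs, abs_of_nonneg (apply_nonneg q y)] at this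
  exact this

theorem eq_zero_of_forall_seminorm [TopologicalSpace X] [PolynormableSpace ℂ X] [T2Space X] {x : X}
    (h : ∀ q : Seminorm ℂ X, Continuous q → q x = 0) : x = 0 := by
  have h1 : Tendsto (fun _ : ℕ => x) atTop (𝓝 0) :=
    tendsto_of_seminorm fun q hq ε hε => by simp [h q hq, hε]
  exact tendsto_nhds_unique tendsto_const_nhds h1

theorem eq_of_forall_dual [TopologicalSpace X] [PolynormableSpace ℂ X] [T2Space X] {x y : X}
    (h : ∀ φ : X →L[ℂ] ℂ, φ x = φ y) : x = y := by
  rw [← sub_eq_zero]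
  refine eq_zero_of_forall_seminorm fun q hq => le_antisymm (seminorm_le_of_dual hq fun φ _ => ?_)
    (apply_nonneg _ _)
  simp [h]

/-- `I` is the weak integral of `f` over `[0, b]`. -/
def HasWeakIntegral [TopologicalSpace X] (f : ℝ → X) (b : ℝ) (I : X) : Prop :=
  ∀ φ : X →L[ℂ] ℂ, φ I = ∫ s in (0 : ℝ)..b, φ (f s)

theorem HasWeakIntegral.seminorm_le [TopologicalSpace X] [PolynormableSpace ℂ X]
    {f : ℝ → X} {b : ℝ} {I : X} (h : HasWeakIntegral f b I)
    (hb : 0 ≤ b) {q : Seminorm ℂ X} (hq : Continuous q) {C : ℝ}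
    (hC : ∀ s ∈ Set.Icc 0 b, q (f s) ≤ C) : q I ≤ C * b := by
  refine seminorm_le_of_dual hq fun φ hφ => ?_
  rw [h φ]
  refine (intervalIntegral.norm_integral_le_of_norm_le_const (C := C) fun s hs => ?_).trans_eq ?_
  · rw [Set.uIoc_of_le hb] at hs
    exact (hφ _).trans (hC s ⟨hs.1.le, hs.2⟩)
  · rw [sub_zero, abs_of_nonneg hb]

/-- Riemann sums of `f` over `[0, 1]`. -/
noncomputable def riemannSum (f : ℝ → X) (n : ℕ) : X :=
  ((n + 1 : ℂ)⁻¹) • ∑ k ∈ Finset.range (n + 1), f (k / (n + 1))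

/-- On each mesh interval the integrand differs from its left endpoint value by at most the
oscillation `ε`. The bound is the same for all `φ` dominated by `q`. -/
theorem norm_riemannSum_sub_integral_le [TopologicalSpace X] {f : ℝ → X} (hf : Continuous f)
    {q : Seminorm ℂ X} {n : ℕ} {ε : ℝ}
    (h : ∀ s ∈ Set.Icc (0 : ℝ) 1, ∀ t ∈ Set.Icc (0 : ℝ) 1, |s - t| ≤ 1 / (n + 1) →
      q (f s - f t) ≤ ε) (φ : X →L[ℂ] ℂ) (hφ : ∀ x, ‖φ x‖ ≤ q x) :
    ‖φ (riemannSum f n) - ∫ s in (0 : ℝ)..1, φ (f s)‖ ≤ ε := by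
  have hn : (0 : ℝ) < n + 1 := by positivity
  have hc : Continuous fun s => φ (f s) := φ.continuous.comp hf
  have hsum := intervalIntegral.sum_integral_adjacent_intervals (μ := MeasureTheory.volume)
    (f := fun s => φ (f s)) (a := fun k : ℕ => (k : ℝ) / (n + 1)) (n := n + 1)
    fun k _ => hc.intervalIntegrable _ _
  have h1 : ((n + 1 : ℕ) : ℝ) / (n + 1) = 1 := by push_cast; field_simp
  simp only [h1, Nat.cast_zero, zero_div] at hsum
  rw [← hsum, riemannSum, map_smul, map_sum, smul_eq_mul, Finset.mul_sum, ← Finset.sum_sub_distrib]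
  refine (norm_sum_le _ _).trans ?_
  have key : ∀ k ∈ Finset.range (n + 1), ‖(n + 1 : ℂ)⁻¹ * φ (f (k / (n + 1))) -
      ∫ s in (k / (n + 1) : ℝ)..((k + 1 : ℕ) / (n + 1) : ℝ), φ (f s)‖ ≤ ε * (1 / (n + 1)) := by
    intro k hk
    have hk' : (k : ℝ) + 1 ≤ n + 1 := by exact_mod_cast Finset.mem_range.1 hk
    have hlen : ((k + 1 : ℕ) / (n + 1) : ℝ) - k / (n + 1) = 1 / (n + 1) := by
      push_cast; ring
    have hlt : (k / (n + 1) : ℝ) ≤ ((k + 1 : ℕ) / (n + 1) : ℝ) := by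
      rw [← sub_nonneg, hlen]; positivity
    have hconst : (n + 1 : ℂ)⁻¹ * φ (f (k / (n + 1))) =
        ∫ s in (k / (n + 1) : ℝ)..((k + 1 : ℕ) / (n + 1) : ℝ), φ (f (k / (n + 1))) := by
      rw [intervalIntegral.integral_const, hlen]
      simp
    rw [hconst, ← intervalIntegral.integral_sub (by simp) (hc.intervalIntegrable _ _)]
    refine (intervalIntegral.norm_integral_le_of_norm_le_const (C := ε) fun s hs => ?_).trans ?_
    · rw [Set.uIoc_of_le hlt] at hs
      have h2 : ((k + 1 : ℕ) / (n + 1) : ℝ) ≤ 1 := by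
        rw [div_le_one hn]; exact_mod_cast hk'
      have h0 : (0 : ℝ) ≤ k / (n + 1) := by positivity
      rw [← map_sub]
      refine (hφ _).trans (h _ ⟨h0, hlt.trans h2⟩ _ ⟨h0.trans hs.1.le, hs.2.trans h2⟩ ?_)
      rw [abs_sub_comm, abs_of_nonneg (by linarith [hs.1])]
      linarith [hs.2]
    · rw [hlen, abs_of_nonneg (by positivity)]
  refine (Finset.sum_le_sum key).trans_eq ?_
  rw [Finset.sum_const, Finset.card_range, nsmul_eq_mul]
  push_cast
  field_simp

variable [UniformSpace X] [IsUniformAddGroup X] 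

theorem eventually_norm_riemannSum_sub_integral_le {f : ℝ → X} (hf : Continuous f)
    {q : Seminorm ℂ X} (hq : Continuous q) {ε : ℝ} (hε : 0 < ε) :
    ∀ᶠ n in atTop, ∀ φ : X →L[ℂ] ℂ, (∀ x, ‖φ x‖ ≤ q x) →
      ‖φ (riemannSum f n) - ∫ s in (0 : ℝ)..1, φ (f s)‖ ≤ ε := by
  have hu := isCompact_Icc.uniformContinuousOn_of_continuous (hf.continuousOn (s := Set.Icc 0 1))
  have hV : {p : X × X | q (p.2 - p.1) < ε} ∈ uniformity X := by
    rw [uniformity_eq_comap_nhds_zero]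
    refine ⟨{x | q x < ε}, ?_, fun p hp => hp⟩
    exact (isOpen_lt hq continuous_const).mem_nhds (by simpa using hε)
  obtain ⟨δ, hδ, hd⟩ := Metric.mem_uniformity_dist.1 (mem_inf_principal.1 (hu hV))
  obtain ⟨N, hN⟩ := exists_nat_one_div_lt hδ
  filter_upwards [eventually_ge_atTop N] with n hn φ hφ
  refine norm_riemannSum_sub_integral_le hf (fun s hs t ht hst => ?_) φ hφ
  have hlt : dist t s < δ := by
    rw [dist_comm, Real.dist_eq]
    refine hst.trans_lt (lt_of_le_of_lt ?_ hN)
    gcongr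
  exact (hd hlt ⟨ht, hs⟩ : q (f s - f t) < ε).le

variable [PolynormableSpace ℂ X]

/-- The Riemann error is small uniformly over all functionals dominated by `q`, so by duality the
Riemann sums are Cauchy for `q`, and sequential completeness gives a limit. -/
theorem exists_hasWeakIntegral_one (hX : IsSeqComplete X) {f : ℝ → X} (hf : Continuous f) :
    ∃ I, HasWeakIntegral f 1 I := by
  have hcs : CauchySeq (riemannSum f) := by
    refine (cauchySeq_iff).2 fun V hV => ?_
    rw [uniformity_eq_comap_nhds_zero] at hV
    obtain ⟨U, hU, hUV⟩ := hV
    obtain ⟨q, hq, r, hr, hqU⟩ := exists_seminorm_ball_subset hU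
    obtain ⟨N, hN⟩ := eventually_atTop.1
      (eventually_norm_riemannSum_sub_integral_le hf hq (show 0 < r / 3 by positivity))
    refine ⟨N, fun k hk l hl => hUV (hqU _ ?_)⟩
    refine lt_of_le_of_lt (seminorm_le_of_dual (C := r / 3 + r / 3) hq fun φ hφ => ?_) (by linarith)
    have := norm_sub_le (φ (riemannSum f l) - ∫ s in (0 : ℝ)..1, φ (f s))
      (φ (riemannSum f k) - ∫ s in (0 : ℝ)..1, φ (f s))
    rw [sub_sub_sub_cancel_right, ← map_sub] at this
    exact this.trans (add_le_add (hN l hl φ hφ) (hN k hk φ hφ))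
  obtain ⟨I, hI⟩ := hX _ hcs
  refine ⟨I, fun φ => ?_⟩
  refine tendsto_nhds_unique ((φ.continuous.tendsto I).comp hI) ?_
  rw [tendsto_iff_norm_sub_tendsto_zero]
  refine Metric.tendsto_nhds.2 fun ε hε => ?_
  -- A single functional is dominated by its own seminorm `‖φ ·‖`, so the uniform estimate applies
  -- to it.
  have hq : Continuous (φ : X →ₗ[ℂ] ℂ).toSeminorm := φ.continuous.norm
  filter_upwards [eventually_norm_riemannSum_sub_integral_le hf hq (half_pos hε)] with n hn
  have := hn φ fun x => le_rfl
  simp only [Function.comp, dist_zero_right, norm_norm]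
  linarith

theorem exists_hasWeakIntegral (hX : IsSeqComplete X) {f : ℝ → X} (hf : Continuous f) (b : ℝ) :
    ∃ I, HasWeakIntegral f b I := by
  obtain ⟨I, hI⟩ := exists_hasWeakIntegral_one hX (hf.comp (continuous_const_mul b))
  refine ⟨(b : ℂ) • I, fun φ => ?_⟩
  have := intervalIntegral.smul_integral_comp_mul_left (fun s => φ (f s)) b (a := 0) (b := 1)
  rw [mul_zero, mul_one] at this
  rw [← this, map_smul, hI φ]
  simp

end WeakIntegral

/-! ### Orbits and their scalar derivatives -/

section Orbits

variable {X : Type*} [AddCommGroup X] [Module ℂ X]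

/-- The orbit `s ↦ T(s) x`, extended by `x` to negative times. -/
def orbit [TopologicalSpace X] (T : ℝ≥0 → X →L[ℂ] X) (x : X) (s : ℝ) : X :=
  T s.toNNReal x

section Topological

variable [TopologicalSpace X] {T : ℝ≥0 → X →L[ℂ] X}

theorem orbit_coe (x : X) (t : ℝ≥0) : orbit T x t = T t x := by
  simp [orbit]

theorem continuous_orbit (hc : IsStronglyContinuous T) (x : X) : Continuous (orbit T x) :=
  (hc x).comp continuous_real_toNNReal

theorem orbit_zero (hT : IsSemigroup T) (x : X) : orbit T x 0 = x := by
  simp [orbit, hT.map_zero]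

theorem apply_orbit (hT : IsSemigroup T) (x : X) (h : ℝ≥0) {s : ℝ} (hs : 0 ≤ s) :
    T h (orbit T x s) = orbit T x (s + h) := by
  rw [orbit, orbit, Real.toNNReal_add hs h.coe_nonneg, Real.toNNReal_coe, add_comm, hT.map_add]
  rfl

theorem orbit_add_period (hT : IsSemigroup T) (x : X) {p : ℝ≥0}
    (hp : T p = ContinuousLinearMap.id ℂ X) {s : ℝ} (hs : 0 ≤ s) :
    orbit T x (s + p) = orbit T x s := by
  rw [← apply_orbit hT x p hs, hp]
  rfl

/-- `T(s)x - T(t)x = T(t)(T(s-t)x - x)` for `s > t`. Only a right derivative is obtained, which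
suffices below. -/
theorem HasGeneratorAt.hasDerivWithinAt (hT : IsSemigroup T) {x y : X} (h : HasGeneratorAt T x y)
    (φ : X →L[ℂ] ℂ) {t : ℝ} (ht : 0 ≤ t) :
    HasDerivWithinAt (fun s => φ (orbit T x s)) (φ (orbit T y t)) (Set.Ici t) t := by
  rw [← hasDerivWithinAt_Ioi_iff_Ici, hasDerivWithinAt_iff_tendsto_slope' (by simp)]
  have hmap : Tendsto (fun s : ℝ => (s - t).toNNReal) (𝓝[>] t) (𝓝[>] 0) := by
    refine tendsto_nhdsWithin_iff.2 ⟨?_, ?_⟩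
    · refine tendsto_nhdsWithin_of_tendsto_nhds ?_
      have : Continuous fun s : ℝ => (s - t).toNNReal := by fun_prop
      simpa using this.tendsto t
    · filter_upwards [self_mem_nhdsWithin] with s hs
      simpa using hs
  have hlim := (((φ.comp (T t.toNNReal)).continuous.tendsto y).comp h).comp hmap
  refine hlim.congr' ?_
  filter_upwards [self_mem_nhdsWithin] with s hs
  have hs0 : 0 ≤ s - t := sub_nonneg.2 (le_of_lt hs)
  have h1 : T t.toNNReal (T (s - t).toNNReal x) = orbit T x s := by
    have h2 := apply_orbit hT x t.toNNReal hs0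
    rwa [Real.coe_toNNReal _ ht, sub_add_cancel] at h2
  simp only [Function.comp, ContinuousLinearMap.comp_apply, map_smul, map_sub, h1,
    Real.coe_toNNReal _ hs0, smul_eq_mul]
  rw [← orbit, slope_def_module]
  simp

end Topological

section Eigenvector

variable [TopologicalSpace X] [T2Space X] [PolynormableSpace ℂ X] {T : ℝ≥0 → X →L[ℂ] X}

/-- The function `e^{-μs} φ(T(s)x)` is continuous with zero right derivative, hence constant. -/
theorem apply_eq_exp_smul (hT : IsSemigroup T) (hc : IsStronglyContinuous T) {μ : ℂ} {x : X}
    (h : HasGeneratorAt T x (μ • x)) (t : ℝ≥0) : T t x = Complex.exp (μ * t) • x := by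
  refine eq_of_forall_dual fun φ => ?_
  have hexp : ∀ s : ℝ, HasDerivAt (fun s : ℝ => Complex.exp (-μ * s))
      (Complex.exp (-μ * s) * -μ) s := fun s => by
    have h1 : HasDerivAt (fun s : ℝ => -μ * (s : ℂ)) (-μ) s := by
      simpa using (Complex.ofRealCLM.hasDerivAt (x := s)).const_mul (-μ)
    exact h1.cexp
  have key := constant_of_has_deriv_right_zero
    (f := fun s : ℝ => Complex.exp (-μ * s) * φ (orbit T x s)) (a := 0) (b := t)
    (Continuous.continuousOn (by
      have := continuous_orbit hc x
      fun_prop))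
    (fun s hs => by
      have h2 := (hexp s).hasDerivWithinAt.mul (h.hasDerivWithinAt hT φ hs.1)
      convert! h2 using 1
      simp only [orbit, map_smul, smul_eq_mul]
      ring) t ⟨t.2, le_rfl⟩
  simp only [orbit_coe, orbit_zero hT, Complex.ofReal_zero, mul_zero, Complex.exp_zero,
    one_mul] at key
  rw [map_smul, ← key, smul_eq_mul, ← mul_assoc, ← Complex.exp_add]
  simp

end Eigenvector

/-! ### Exponentially weighted integrals of orbits -/

section WeakIntegralOrbit

theorem HasWeakIntegral.unique [TopologicalSpace X] [T2Space X] [PolynormableSpace ℂ X]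
    {f : ℝ → X} {b : ℝ} {I J : X} (hI : HasWeakIntegral f b I) (hJ : HasWeakIntegral f b J) :
    I = J :=
  eq_of_forall_dual fun φ => (hI φ).trans (hJ φ).symm

theorem HasWeakIntegral.tendsto_inv_smul [TopologicalSpace X] [PolynormableSpace ℂ X]
    {f : ℝ → X} (hf : Continuous f) {V : ℝ≥0 → X} (hV : ∀ h : ℝ≥0, HasWeakIntegral f h (V h)) :
    Tendsto (fun h : ℝ≥0 => ((h : ℝ) : ℂ)⁻¹ • V h) (𝓝[>] 0) (𝓝 (f 0)) := by
  have := (PolynormableSpace.withSeminorms ℂ X).topologicalAddGroup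
  refine tendsto_of_seminorm fun q hq ε hε => ?_
  have hcont : Continuous fun s => q (f s - f 0) := hq.comp (hf.sub continuous_const)
  have hev : ∀ᶠ s in 𝓝 (0 : ℝ), q (f s - f 0) < ε / 2 :=
    hcont.continuousAt.eventually_lt continuousAt_const (by simpa using half_pos hε)
  obtain ⟨δ, hδ, hd⟩ := Metric.eventually_nhds_iff.1 hev
  have h1 : ∀ᶠ h : ℝ≥0 in 𝓝[>] 0, (h : ℝ) < δ :=
    eventually_nhdsWithin_of_eventually_nhds
      (NNReal.continuous_coe.continuousAt.eventually_lt continuousAt_const (by simpa using hδ))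
  filter_upwards [h1, self_mem_nhdsWithin] with h hlt hpos
  have hpos' : (0 : ℝ) < h := hpos
  have hw : HasWeakIntegral (fun s => f s - f 0) h (V h - ((h : ℝ) : ℂ) • f 0) := fun φ => by
    have hc : Continuous fun s => φ (f s) := φ.continuous.comp hf
    simp only [map_sub, map_smul, hV h φ]
    rw [intervalIntegral.integral_sub (hc.intervalIntegrable _ _) (by simp)]
    simp
  have hle := hw.seminorm_le hpos'.le hq (C := ε / 2) fun s hs => by
    refine (hd ?_).le
    rw [Real.dist_eq, sub_zero, abs_of_nonneg hs.1]
    exact hs.2.trans_lt hlt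
  have hne : ((h : ℝ) : ℂ) ≠ 0 := by exact_mod_cast hpos'.ne'
  have heq : ((h : ℝ) : ℂ)⁻¹ • V h - f 0 = ((h : ℝ) : ℂ)⁻¹ • (V h - ((h : ℝ) : ℂ) • f 0) := by
    rw [smul_sub, smul_smul, inv_mul_cancel₀ hne, one_smul]
  rw [heq, map_smul_eq_mul, norm_inv, Complex.norm_real, Real.norm_eq_abs, abs_of_pos hpos']
  calc (h : ℝ)⁻¹ * q (V h - ((h : ℝ) : ℂ) • f 0) ≤ (h : ℝ)⁻¹ * (ε / 2 * h) := by gcongr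
    _ = ε / 2 := by field_simp
    _ < ε := half_lt_self hε

variable [TopologicalSpace X] [PolynormableSpace ℂ X] {T : ℝ≥0 → X →L[ℂ] X}

/-- Differentiate the formula for `T(h)y` at `h = 0`: the exponential contributes `μ • y`, and `V h
/ h` tends to `x`. -/
theorem hasGeneratorAt_of_weakIntegral (hT : IsSemigroup T) (hc : IsStronglyContinuous T)
    {μ c : ℂ} {x y : X} {V : ℝ≥0 → X}
    (hV : ∀ h : ℝ≥0, HasWeakIntegral (fun s : ℝ => Complex.exp (-μ * s) • orbit T x s) h (V h))
    (hy : ∀ h : ℝ≥0, T h y = Complex.exp (μ * h) • (y + c • V h)) :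
    HasGeneratorAt T y (μ • y + c • x) := by
  have := (PolynormableSpace.withSeminorms ℂ X).topologicalAddGroup
  have := (PolynormableSpace.withSeminorms ℂ X).continuousSMul
  have hcv : Continuous fun s : ℝ => Complex.exp (-μ * s) • orbit T x s := by
    have := continuous_orbit hc x
    fun_prop
  have h1 := HasWeakIntegral.tendsto_inv_smul hcv hV
  simp only [Complex.ofReal_zero, mul_zero, Complex.exp_zero, one_smul, orbit_zero hT] at h1
  have h2 : Tendsto (fun h : ℝ≥0 => ((h : ℝ) : ℂ)⁻¹ * (Complex.exp (μ * h) - 1)) (𝓝[>] 0)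
      (𝓝 μ) := by
    have hd : HasDerivAt (fun s : ℝ => Complex.exp (μ * s)) μ 0 := by
      have h1 : HasDerivAt (fun s : ℝ => μ * (s : ℂ)) μ 0 := by
        simpa using (Complex.ofRealCLM.hasDerivAt (x := (0 : ℝ))).const_mul μ
      simpa using h1.cexp
    have hs := hasDerivAt_iff_tendsto_slope.1 hd
    have hm : Tendsto (fun h : ℝ≥0 => (h : ℝ)) (𝓝[>] 0) (𝓝[≠] 0) := by
      refine tendsto_nhdsWithin_iff.2 ⟨?_, ?_⟩
      · refine tendsto_nhdsWithin_of_tendsto_nhds ?_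
        simpa using NNReal.continuous_coe.tendsto 0
      · filter_upwards [self_mem_nhdsWithin] with s hs
        simpa using (ne_of_gt hs : s ≠ 0)
    refine (hs.comp hm).congr fun h => ?_
    simp [slope_def_module]
  have h3 : Tendsto (fun h : ℝ≥0 => c * Complex.exp (μ * h)) (𝓝[>] 0) (𝓝 c) := by
    have : Continuous fun h : ℝ≥0 => c * Complex.exp (μ * (h : ℝ)) := by fun_prop
    exact tendsto_nhdsWithin_of_tendsto_nhds (by simpa using this.tendsto 0)
  refine ((h2.smul_const y).add (h3.smul h1)).congr fun h => ?_
  rw [hy h]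
  module

theorem integral_comp_add_eq {g : ℝ → ℂ} (hg : Continuous g) (p h : ℝ) :
    ∫ s in (0 : ℝ)..p, g (s + h) =
      (∫ s in (0 : ℝ)..p, g s) + ((∫ s in (0 : ℝ)..h, g (s + p)) - ∫ s in (0 : ℝ)..h, g s) := by
  have hi : ∀ a b, IntervalIntegrable g MeasureTheory.volume a b := fun a b =>
    hg.intervalIntegrable a b
  simp only [intervalIntegral.integral_comp_add_right, zero_add]
  have h1 := intervalIntegral.integral_add_adjacent_intervals (hi 0 h) (hi h (p + h))
  have h2 := intervalIntegral.integral_add_adjacent_intervals (hi 0 p) (hi p (p + h))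
  rw [add_comm h p]
  linear_combination h1 - h2

/-- `T(h)` moves the window `[0, p]` to `[h, p + h]` at the cost of `e^{μh}`. The piece over `[p, p
+ h]` is, by periodicity, `e^{-μp}` times the lost piece over `[0, h]`. -/
theorem apply_weakIntegral_exp [T2Space X] (hT : IsSemigroup T) (hc : IsStronglyContinuous T)
    {p : ℝ≥0} (hp : T p = ContinuousLinearMap.id ℂ X) {μ : ℂ} {x y : X} {h : ℝ≥0} {V : X}
    (hV : HasWeakIntegral (fun s : ℝ => Complex.exp (-μ * s) • orbit T x s) h V)
    (hy : HasWeakIntegral (fun s : ℝ => Complex.exp (-μ * s) • orbit T x s) p y) :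
    T h y = Complex.exp (μ * h) • (y + (Complex.exp (-μ * p) - 1) • V) := by
  refine eq_of_forall_dual fun φ => ?_
  set g : ℝ → ℂ := fun s => Complex.exp (-μ * s) * φ (orbit T x s) with hg
  have hgc : Continuous g := by
    have := continuous_orbit hc x
    fun_prop
  have e1 : φ (T h y) = Complex.exp (μ * h) * ∫ s in (0 : ℝ)..p, g (s + h) := by
    rw [← ContinuousLinearMap.comp_apply, hy, ← intervalIntegral.integral_const_mul]
    refine intervalIntegral.integral_congr fun s hs => ?_
    rw [Set.uIcc_of_le p.coe_nonneg] at hs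
    simp only [ContinuousLinearMap.comp_apply, map_smul, apply_orbit hT x h hs.1, smul_eq_mul, hg]
    rw [← mul_assoc, ← Complex.exp_add]
    push_cast
    ring_nf
  have e2 : ∫ s in (0 : ℝ)..h, g (s + p) = Complex.exp (-μ * p) * ∫ s in (0 : ℝ)..h, g s := by
    rw [← intervalIntegral.integral_const_mul]
    refine intervalIntegral.integral_congr fun s hs => ?_
    rw [Set.uIcc_of_le h.coe_nonneg] at hs
    simp only [hg, orbit_add_period hT x hp hs.1]
    rw [← mul_assoc, ← Complex.exp_add]
    push_cast
    ring_nf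
  rw [e1, integral_comp_add_eq hgc, e2]
  simp only [map_smul, map_add, hy φ, hV φ, smul_eq_mul, hg]
  ring

/-- With `e^{-μp} = 1` the weighted orbit is itself periodic; only the weight `s` changes on passing
a period, growing by `p`. -/
theorem apply_weakIntegral_mul_exp [T2Space X] (hT : IsSemigroup T) (hc : IsStronglyContinuous T)
    {p : ℝ≥0} (hp : T p = ContinuousLinearMap.id ℂ X) {μ : ℂ} (hμ : Complex.exp (-μ * p) = 1)
    {x y : X} {h : ℝ≥0} {V : X}
    (h0 : HasWeakIntegral (fun s : ℝ => Complex.exp (-μ * s) • orbit T x s) p 0)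
    (hV : HasWeakIntegral (fun s : ℝ => Complex.exp (-μ * s) • orbit T x s) h V)
    (hy : HasWeakIntegral (fun s : ℝ => (s * Complex.exp (-μ * s)) • orbit T x s) p y) :
    T h y = Complex.exp (μ * h) • (y + (p : ℂ) • V) := by
  refine eq_of_forall_dual fun φ => ?_
  set g : ℝ → ℂ := fun s => Complex.exp (-μ * s) * φ (orbit T x s) with hg
  have hgc : Continuous g := by
    have := continuous_orbit hc x
    fun_prop
  have hper : ∀ s : ℝ, 0 ≤ s → g (s + p) = g s := fun s hs => by
    have : -μ * ((s + p : ℝ) : ℂ) = -μ * s + -μ * p := by push_cast; ring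
    simp only [hg, orbit_add_period hT x hp hs, this, Complex.exp_add, hμ, mul_one]
  have hG : Continuous fun s : ℝ => (s : ℂ) * g s := by fun_prop
  have e0 : ∫ s in (0 : ℝ)..p, g s = 0 := by
    have := h0 φ
    simpa [hg] using this.symm
  have e1 : φ (T h y) = Complex.exp (μ * h) * ∫ s in (0 : ℝ)..p, (s : ℂ) * g (s + h) := by
    rw [← ContinuousLinearMap.comp_apply, hy, ← intervalIntegral.integral_const_mul]
    refine intervalIntegral.integral_congr fun s hs => ?_
    rw [Set.uIcc_of_le p.coe_nonneg] at hs
    simp only [ContinuousLinearMap.comp_apply, map_smul, apply_orbit hT x h hs.1, smul_eq_mul, hg]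
    have : Complex.exp (-μ * s) = Complex.exp (μ * h) * Complex.exp (-μ * ((s + h : ℝ) : ℂ)) := by
      rw [← Complex.exp_add]
      push_cast
      ring_nf
    rw [this]
    ring
  have e2 : ∫ s in (0 : ℝ)..p, g (s + h) = 0 := by
    rw [integral_comp_add_eq hgc, e0, sub_eq_zero.2, add_zero]
    refine intervalIntegral.integral_congr fun s hs => ?_
    rw [Set.uIcc_of_le h.coe_nonneg] at hs
    exact hper s hs.1
  -- Write `s = (s + h) - h`; the term with `h` drops out because the integral of `g` over a full
  -- period is zero.
  have e3 : ∫ s in (0 : ℝ)..p, (s : ℂ) * g (s + h) =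
      (∫ s in (0 : ℝ)..p, ((s + h : ℝ) : ℂ) * g (s + h)) - h * ∫ s in (0 : ℝ)..p, g (s + h) := by
    rw [← intervalIntegral.integral_const_mul, ← intervalIntegral.integral_sub]
    · refine intervalIntegral.integral_congr fun s _ => ?_
      push_cast
      ring
    all_goals
      apply Continuous.intervalIntegrable
      fun_prop
  have e4 : (∫ s in (0 : ℝ)..h, ((s + p : ℝ) : ℂ) * g (s + p)) - ∫ s in (0 : ℝ)..h, (s : ℂ) * g s =
      p * ∫ s in (0 : ℝ)..h, g s := by
    rw [← intervalIntegral.integral_const_mul, ← intervalIntegral.integral_sub]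
    · refine intervalIntegral.integral_congr fun s hs => ?_
      rw [Set.uIcc_of_le h.coe_nonneg] at hs
      simp only [hper s hs.1]
      push_cast
      ring
    all_goals
      apply Continuous.intervalIntegrable
      fun_prop
  rw [e1, e3, e2, integral_comp_add_eq hG, e4]
  simp only [map_smul, map_add, hy φ, hV φ, smul_eq_mul, hg, mul_assoc]
  ring

end WeakIntegralOrbit

end Orbits

/-! ### Generator, eigenvectors and kernel bounds -/

section Spectrum

variable {X : Type*} [AddCommGroup X] [Module ℂ X]

theorem HasWeakIntegral.const_smul [TopologicalSpace X] {f : ℝ → X} {b : ℝ} {I : X}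
    (h : HasWeakIntegral f b I) (c : ℂ) : HasWeakIntegral (fun s => c • f s) b (c • I) := fun φ => by
  simp only [map_smul, smul_eq_mul, intervalIntegral.integral_const_mul, h φ]

theorem HasWeakIntegral.add [TopologicalSpace X] {f g : ℝ → X} (hf : Continuous f)
    (hg : Continuous g) {b : ℝ} {I J : X} (hI : HasWeakIntegral f b I)
    (hJ : HasWeakIntegral g b J) : HasWeakIntegral (fun s => f s + g s) b (I + J) := fun φ => by
  simp only [map_add, hI φ, hJ φ]
  rw [intervalIntegral.integral_add]
  · exact (φ.continuous.comp hf).intervalIntegrable _ _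
  · exact (φ.continuous.comp hg).intervalIntegrable _ _

/-- The constant depends on the kernel only through its sup bound `M`, so this yields both
continuity of one operator and equicontinuity of a family. -/
theorem seminorm_weakIntegral_smul_orbit_le [TopologicalSpace X] [PolynormableSpace ℂ X]
    {T : ℝ≥0 → X →L[ℂ] X} {q r : Seminorm ℂ X} (hq : Continuous q)
    {b C : ℝ≥0} (hqr : ∀ t ≤ b, ∀ x : X, q (T t x) ≤ C * r x) {k : ℝ → ℂ} {M : ℝ}
    (hM : ∀ s ∈ Set.Icc (0 : ℝ) b, ‖k s‖ ≤ M) {x y : X}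
    (hy : HasWeakIntegral (fun s => k s • orbit T x s) b y) : q y ≤ M * C * b * r x := by
  refine (hy.seminorm_le b.coe_nonneg hq (C := M * (C * r x)) fun s hs => ?_).trans_eq (by ring)
  rw [map_smul_eq_mul]
  have h1 : s.toNNReal ≤ b := by
    rw [Real.toNNReal_le_iff_le_coe]
    exact hs.2
  exact mul_le_mul (hM s hs) (hqr _ h1 x) (apply_nonneg _ _) ((norm_nonneg _).trans (hM s hs))

section Generator

variable [TopologicalSpace X] [IsTopologicalAddGroup X] [ContinuousSMul ℂ X] [T2Space X]
  {T : ℝ≥0 → X →L[ℂ] X}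

theorem HasGeneratorAt.exists_mem_domain {x y : X} (h : HasGeneratorAt T x y) :
    ∃ hx : x ∈ (generator T).domain, generator T ⟨x, hx⟩ = y :=
  ⟨⟨y, h⟩, (hasGeneratorAt_generator _).unique h⟩

theorem HasGeneratorAt.mem_pointSpectrum {x : X} {μ : ℂ} (h : HasGeneratorAt T x (μ • x))
    (hx : x ≠ 0) : μ ∈ pointSpectrum (generator T) := by
  obtain ⟨hd, he⟩ := h.exists_mem_domain
  intro hinj
  have h1 : shift (generator T) μ ⟨x, hd⟩ = shift (generator T) μ 0 := by
    rw [map_zero]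
    change μ • x - generator T ⟨x, hd⟩ = 0
    rw [he, sub_self]
  exact hx (congrArg Subtype.val (hinj h1))

theorem HasGeneratorAt.mem_eigenvectors {x : X} {μ : ℂ} (h : HasGeneratorAt T x (μ • x))
    (hx : x ≠ 0) : x ∈ eigenvectors (generator T) :=
  ⟨hx, μ, h.mem_pointSpectrum hx, h.exists_mem_domain⟩

theorem exists_eigenvector_of_mem_pointSpectrum {μ : ℂ} (h : μ ∈ pointSpectrum (generator T)) :
    ∃ x, x ≠ 0 ∧ HasGeneratorAt T x (μ • x) := by
  change ¬ Function.Injective _ at h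
  rw [injective_iff_map_eq_zero] at h
  push Not at h
  obtain ⟨x, hx, hne⟩ := h
  refine ⟨x, fun h0 => hne (Subtype.ext h0), ?_⟩
  have h1 : μ • (x : X) - generator T x = 0 := hx
  rw [sub_eq_zero.1 h1]
  exact hasGeneratorAt_generator x

variable [PolynormableSpace ℂ X]

theorem exp_eq_one_of_mem_pointSpectrum (hT : IsSemigroup T) (hc : IsStronglyContinuous T)
    {p : ℝ≥0} (hp : T p = ContinuousLinearMap.id ℂ X) {μ : ℂ}
    (h : μ ∈ pointSpectrum (generator T)) : Complex.exp (μ * p) = 1 := by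
  obtain ⟨x, hx, hg⟩ := exists_eigenvector_of_mem_pointSpectrum h
  have h1 := apply_eq_exp_smul hT hc hg p
  rw [hp, ContinuousLinearMap.id_apply] at h1
  have h2 : (Complex.exp (μ * p) - 1) • x = 0 := by rw [sub_smul, one_smul, ← h1, sub_self]
  exact sub_eq_zero.1 ((smul_eq_zero.1 h2).resolve_right hx)

theorem isPeriodic_of_dense_eigenvectors (hT : IsSemigroup T) (hc : IsStronglyContinuous T)
    {α : ℝ} (hα : 0 < α) (hsub : pointSpectrum (generator T) ⊆
      Set.range fun n : ℤ => 2 * (Real.pi : ℂ) * Complex.I * (α : ℂ) * (n : ℂ))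
    (hd : Dense (Submodule.span ℂ (eigenvectors (generator T)) : Set X)) : IsPeriodic T := by
  have hpos : 0 < α⁻¹ := inv_pos.2 hα
  refine ⟨α⁻¹.toNNReal, Real.toNNReal_pos.2 hpos, ?_⟩
  refine ContinuousLinearMap.ext_on hd fun x hx => ?_
  obtain ⟨_, μ, hμ, hdom, he⟩ := hx
  have hg : HasGeneratorAt T x (μ • x) := he ▸ hasGeneratorAt_generator ⟨x, hdom⟩
  obtain ⟨n, rfl⟩ := hsub hμ
  rw [apply_eq_exp_smul hT hc hg, ContinuousLinearMap.id_apply]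
  have hα' : (α : ℂ) ≠ 0 := by exact_mod_cast hα.ne'
  have : 2 * (Real.pi : ℂ) * Complex.I * α * n * ((α⁻¹ : ℝ) : ℂ) = n * (2 * Real.pi * Complex.I) := by
    push_cast
    field_simp
  rw [Real.coe_toNNReal _ hpos.le, this, Complex.exp_int_mul_two_pi_mul_I, one_smul]

end Generator

/-! ### Spectrum and eigenvectors of a periodic semigroup -/

section Periodic

variable [UniformSpace X] [IsUniformAddGroup X] [T2Space X] [PolynormableSpace ℂ X]
  {T : ℝ≥0 → X →L[ℂ] X}

theorem hasGeneratorAt_weakIntegral_exp (hX : IsSeqComplete X) (hT : IsSemigroup T)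
    (hc : IsStronglyContinuous T) {p : ℝ≥0} (hp : T p = ContinuousLinearMap.id ℂ X) {μ : ℂ}
    {x y : X}
    (hy : HasWeakIntegral (fun s : ℝ => Complex.exp (-μ * s) • orbit T x s) p y) :
    HasGeneratorAt T y (μ • y + (Complex.exp (-μ * p) - 1) • x) := by
  have := (PolynormableSpace.withSeminorms ℂ X).continuousSMul
  have hcv : Continuous fun s : ℝ => Complex.exp (-μ * s) • orbit T x s := by
    have := continuous_orbit hc x
    fun_prop
  choose V hV using fun h : ℝ≥0 => exists_hasWeakIntegral hX hcv h
  exact hasGeneratorAt_of_weakIntegral hT hc hV fun h => apply_weakIntegral_exp hT hc hp (hV h) hy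

theorem hasGeneratorAt_weakIntegral_mul_exp (hX : IsSeqComplete X) (hT : IsSemigroup T)
    (hc : IsStronglyContinuous T) {p : ℝ≥0} (hp : T p = ContinuousLinearMap.id ℂ X) {μ : ℂ}
    (hμ : Complex.exp (-μ * p) = 1) {x y : X}
    (h0 : HasWeakIntegral (fun s : ℝ => Complex.exp (-μ * s) • orbit T x s) p 0)
    (hy : HasWeakIntegral (fun s : ℝ => (s * Complex.exp (-μ * s)) • orbit T x s) p y) :
    HasGeneratorAt T y (μ • y + (p : ℂ) • x) := by
  have := (PolynormableSpace.withSeminorms ℂ X).continuousSMul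
  have hcv : Continuous fun s : ℝ => Complex.exp (-μ * s) • orbit T x s := by
    have := continuous_orbit hc x
    fun_prop
  choose V hV using fun h : ℝ≥0 => exists_hasWeakIntegral hX hcv h
  exact hasGeneratorAt_of_weakIntegral hT hc hV fun h =>
    apply_weakIntegral_mul_exp hT hc hp hμ h0 (hV h) hy

variable [ContinuousSMul ℂ X]

/-- The vanishing coefficients are trivially summable, so the Fourier series of the periodic
extension converges pointwise to it, and its sum is zero. -/
theorem eq_zero_of_fourierCoeffOn_eq_zero {p : ℝ} (hp : 0 < p) {g : ℝ → ℂ} (hg : Continuous g)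
    (hgp : g 0 = g p)
    (h : ∀ n : ℤ, ∫ s in (0 : ℝ)..p, Complex.exp (-(2 * Real.pi * Complex.I * n / p) * s) * g s = 0) :
    g 0 = 0 := by
  have : Fact (0 < p) := ⟨hp⟩
  let F : C(AddCircle p, ℂ) :=
    ⟨AddCircle.liftIco p 0 g, AddCircle.liftIco_zero_continuous hgp hg.continuousOn⟩
  have hF : ∀ n, fourierCoeff F n = 0 := fun n => by
    change fourierCoeff (AddCircle.liftIco p 0 g) n = 0
    rw [fourierCoeff_liftIco_eq, fourierCoeffOn_eq_integral]
    simp only [zero_add, sub_zero, smul_eq_mul, fourier_coe_apply]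
    rw [smul_eq_zero]
    right
    rw [← h n]
    refine intervalIntegral.integral_congr fun s _ => ?_
    push_cast
    ring_nf
  have hs := has_pointwise_sum_fourier_series_of_summable (f := F)
    (by simpa only [funext hF] using summable_zero) ((0 : ℝ) : AddCircle p)
  simp only [hF, zero_smul] at hs
  have h0 : F ((0 : ℝ) : AddCircle p) = g 0 :=
    AddCircle.liftIco_zero_coe_apply ⟨le_rfl, hp⟩
  rw [← h0]
  exact hs.unique hasSum_zero

/-- Otherwise Hahn-Banach separates some `z` from the closed span by `φ`. The Fourier coefficients
of `s ↦ φ(T(s)z)` are, up to scaling, values of `φ` at eigenvectors or zero, so they vanish and `φ z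
= 0`. -/
theorem dense_span_eigenvectors [LocallyConvexSpace ℝ X] (hX : IsSeqComplete X)
    (hT : IsSemigroup T) (hc : IsStronglyContinuous T) {p : ℝ≥0} (hp0 : 0 < p)
    (hp : T p = ContinuousLinearMap.id ℂ X) :
    Dense (Submodule.span ℂ (eigenvectors (generator T)) : Set X) := by
  set S := Submodule.span ℂ (eigenvectors (generator T)) with hS
  intro z
  by_contra hz
  obtain ⟨φ, u, hlt, huz⟩ := RCLike.geometric_hahn_banach_closed_point (𝕜 := ℂ)
    (s := (S.topologicalClosure : Set X)) (S.topologicalClosure.restrictScalars ℝ).convex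
    S.isClosed_topologicalClosure hz
  have hker : ∀ a ∈ S, φ a = 0 := fun a ha => by
    by_contra hne
    -- This multiple of `a` lies in the subspace and has `φ`-value exactly `u`, contradicting the
    -- strict bound.
    have h1 := hlt (((u : ℂ) / φ a) • a) (S.le_topologicalClosure (S.smul_mem _ ha))
    rw [map_smul, smul_eq_mul, div_mul_cancel₀ _ hne] at h1
    simp at h1
  have hu : 0 < u := by simpa using hlt 0 S.topologicalClosure.zero_mem
  have hp0' : (0 : ℝ) < p := hp0
  have hpc : ((p : ℝ) : ℂ) ≠ 0 := by exact_mod_cast hp0'.ne'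
  have hcz := continuous_orbit hc z
  have hφz : φ (orbit T z 0) = 0 := by
    refine eq_zero_of_fourierCoeffOn_eq_zero (g := fun s => φ (orbit T z s)) hp0'
      (φ.continuous.comp hcz) ?_ fun n => ?_
    · simpa using congrArg φ (orbit_add_period hT z hp le_rfl).symm
    · set μ : ℂ := 2 * Real.pi * Complex.I * n / (p : ℝ) with hμ
      obtain ⟨y, hy⟩ := exists_hasWeakIntegral hX
        (f := fun s : ℝ => Complex.exp (-μ * s) • orbit T z s) (by fun_prop) p
      have hgen := hasGeneratorAt_weakIntegral_exp hX hT hc hp hy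
      have hexp : Complex.exp (-μ * (p : ℝ)) = 1 := by
        rw [Complex.exp_eq_one_iff]
        refine ⟨-n, ?_⟩
        rw [hμ]
        push_cast
        field_simp
      rw [hexp, sub_self, zero_smul, add_zero] at hgen
      have hyS : y ∈ S := by
        by_cases hy0 : y = 0
        · rw [hy0]; exact S.zero_mem
        · exact Submodule.subset_span (hgen.mem_eigenvectors hy0)
      have h1 := hy φ
      rw [hker y hyS] at h1
      simpa using h1.symm
  rw [orbit_zero hT] at hφz
  rw [hφz] at huz
  simp at huz
  linarith

theorem exists_kernelOperator (hX : IsSeqComplete X) (hc : IsStronglyContinuous T)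
    (he : IsLocallyEquicontinuous T) {k : ℝ → ℂ} (hk : Continuous k) (b : ℝ≥0) :
    ∃ K : X →L[ℂ] X, ∀ x, HasWeakIntegral (fun s => k s • orbit T x s) b (K x) := by
  have hcont : ∀ x, Continuous fun s => k s • orbit T x s := fun x =>
    hk.smul (continuous_orbit hc x)
  choose K hK using fun x => exists_hasWeakIntegral hX (hcont x) b
  let L : X →ₗ[ℂ] X :=
    { toFun := K
      map_add' := fun x x' => (hK _).unique (by
        simpa only [orbit, map_add, smul_add] using (hK x).add (hcont x) (hcont x') (hK x'))
      map_smul' := fun c x => (hK _).unique (by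
        simpa only [orbit, map_smul, smul_comm c, RingHom.id_apply] using (hK x).const_smul c) }
  refine ⟨⟨L, ?_⟩, hK⟩
  refine (PolynormableSpace.withSeminorms ℂ X).continuous_of_continuous_comp _ fun q => ?_
  obtain ⟨r, hr, C, hC⟩ := he q.1 q.2 b
  obtain ⟨M, hM⟩ := isCompact_Icc.exists_bound_of_continuousOn (hk.continuousOn (s := Set.Icc (0 : ℝ) b))
  have hM0 : 0 ≤ M := (norm_nonneg _).trans (hM 0 ⟨le_rfl, b.2⟩)
  lift M to ℝ≥0 using hM0
  refine Seminorm.continuous_of_le (q := (M * C * b) • r) (hr.const_smul _) fun x => ?_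
  exact seminorm_weakIntegral_smul_orbit_le q.2 hC hM (hK x)

/-- The generator identity makes `K ν` a right inverse of `ν - A`; injectivity promotes it to a
two-sided one. The resolvent therefore equals `K ν`, and the seminorm bounds give equicontinuity. -/
theorem mem_resolventSetStar_of_operators {μ : ℂ} {δ : ℝ} (hδ : 0 < δ) (K : ℂ → X →L[ℂ] X)
    (hinj : ∀ ν ∈ Metric.ball μ δ, ν ∉ pointSpectrum (generator T))
    (hK : ∀ ν ∈ Metric.ball μ δ, ∀ x, HasGeneratorAt T (K ν x) (ν • K ν x - x))
    (hbd : ∀ q : Seminorm ℂ X, Continuous q → ∃ r : Seminorm ℂ X, Continuous r ∧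
      ∃ C : ℝ≥0, ∀ ν ∈ Metric.ball μ δ, ∀ x, q (K ν x) ≤ C * r x) :
    μ ∈ resolventSetStar (generator T) := by
  have hright : ∀ ν ∈ Metric.ball μ δ, ∀ x, ∃ h : K ν x ∈ (generator T).domain,
      shift (generator T) ν ⟨K ν x, h⟩ = x := fun ν hν x => by
    obtain ⟨h, hA⟩ := (hK ν hν x).exists_mem_domain
    refine ⟨h, ?_⟩
    change ν • K ν x - generator T ⟨K ν x, h⟩ = x
    rw [hA, sub_sub_cancel]
  have hi : ∀ ν ∈ Metric.ball μ δ, Function.Injective (shift (generator T) ν) := fun ν hν =>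
    not_not.1 (hinj ν hν)
  have hleft : ∀ ν ∈ Metric.ball μ δ, ∀ x : (generator T).domain,
      K ν (shift (generator T) ν x) = x := fun ν hν x => by
    obtain ⟨h, hs⟩ := hright ν hν (shift (generator T) ν x)
    exact congrArg Subtype.val (hi ν hν hs)
  have hres : Metric.ball μ δ ⊆ resolventSet (generator T) := fun ν hν =>
    ⟨⟨hi ν hν, fun x => ⟨_, (hright ν hν x).2⟩⟩, K ν, hleft ν hν⟩
  refine ⟨hres (Metric.mem_ball_self hδ), δ, hδ, hres, ?_⟩
  have heq : ∀ (ν : Metric.ball μ δ) (x : X),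
      resolvent (generator T) ⟨ν, hres ν.2⟩ x = K ν x := fun ν x => by
    obtain ⟨h, hs⟩ := hright ν ν.2 x
    conv_lhs => rw [← hs]
    exact resolvent_shift (generator T) ⟨ν, hres ν.2⟩ ⟨K ν x, h⟩
  simp only [heq]
  refine ((PolynormableSpace.withSeminorms ℂ X).equicontinuous_TFAE
    (fun ν : Metric.ball μ δ => (K ν : X →ₗ[ℂ] X))).out 3 1 |>.1 fun q => ?_
  obtain ⟨r, hr, C, hC⟩ := hbd q.1 q.2
  exact ⟨C • r, hr.const_smul C, fun ν x => hC ν ν.2 x⟩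

theorem mem_resolventSetStar_of_kernel (hX : IsSeqComplete X) (hc : IsStronglyContinuous T)
    (he : IsLocallyEquicontinuous T) {μ : ℂ} {δ : ℝ} (hδ : 0 < δ) {k : ℂ → ℝ → ℂ} {M : ℝ}
    {b : ℝ≥0} (hk : ∀ ν, Continuous (k ν))
    (hM : ∀ ν ∈ Metric.ball μ δ, ∀ s ∈ Set.Icc (0 : ℝ) b, ‖k ν s‖ ≤ M)
    (hinj : ∀ ν ∈ Metric.ball μ δ, ν ∉ pointSpectrum (generator T))
    (hgen : ∀ ν ∈ Metric.ball μ δ, ∀ x y, HasWeakIntegral (fun s => k ν s • orbit T x s) b y →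
      HasGeneratorAt T y (ν • y - x)) :
    μ ∈ resolventSetStar (generator T) := by
  choose K hK using fun ν => exists_kernelOperator hX hc he (hk ν) b
  have hM0 : 0 ≤ M :=
    (norm_nonneg _).trans (hM μ (Metric.mem_ball_self hδ) 0 ⟨le_rfl, b.2⟩)
  refine mem_resolventSetStar_of_operators hδ K hinj (fun ν hν x => hgen ν hν x _ (hK ν x))
    fun q hq => ?_
  obtain ⟨r, hr, C, hC⟩ := he q hq b
  lift M to ℝ≥0 using hM0
  exact ⟨r, hr, M * C * b, fun ν hν x =>
    seminorm_weakIntegral_smul_orbit_le hq hC (hM ν hν) (hK ν x)⟩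

theorem hasGeneratorAt_weakIntegral_of_exp_ne_one (hX : IsSeqComplete X) (hT : IsSemigroup T)
    (hc : IsStronglyContinuous T) {p : ℝ≥0} (hp : T p = ContinuousLinearMap.id ℂ X) {ν : ℂ}
    (hν : Complex.exp (-ν * p) ≠ 1) {x y : X}
    (hy : HasWeakIntegral (fun s : ℝ =>
      ((1 - Complex.exp (-ν * p))⁻¹ * Complex.exp (-ν * s)) • orbit T x s) p y) :
    HasGeneratorAt T y (ν • y - x) := by
  have hne : 1 - Complex.exp (-ν * p) ≠ 0 := sub_ne_zero.2 hν.symm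
  have h1 := hy.const_smul (1 - Complex.exp (-ν * p))
  simp only [smul_smul, mul_inv_cancel_left₀ hne] at h1
  have h2 := (hasGeneratorAt_weakIntegral_exp hX hT hc hp h1).smul (1 - Complex.exp (-ν * p))⁻¹
  have h3 : (1 - Complex.exp (-ν * p))⁻¹ * (Complex.exp (-ν * p) - 1) = -1 := by
    rw [← neg_sub 1 (Complex.exp _), mul_neg, inv_mul_cancel₀ hne]
  rw [smul_add, smul_comm _ ν, smul_smul _ _ y, inv_mul_cancel₀ hne, one_smul, smul_smul _ _ x, h3,
    neg_smul, one_smul, ← sub_eq_add_neg] at h2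
  exact h2

theorem norm_exp_neg_mul_le {μ : ℂ} {s b : ℝ} (hs : s ∈ Set.Icc 0 b) :
    ‖Complex.exp (-μ * s)‖ ≤ Real.exp (‖μ‖ * b) := by
  refine (Complex.norm_exp_le_exp_norm _).trans (Real.exp_le_exp.2 ?_)
  rw [norm_mul, norm_neg, Complex.norm_real, Real.norm_eq_abs, abs_of_nonneg hs.1]
  exact mul_le_mul_of_nonneg_left hs.2 (norm_nonneg _)

/-- `|e^z - 1| ≥ |z| - |z|²`, and `|z|² ≤ |z|/2` here. -/
theorem half_norm_le_norm_exp_sub_one {z : ℂ} (hz : ‖z‖ ≤ 1 / 2) :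
    ‖z‖ / 2 ≤ ‖Complex.exp z - 1‖ := by
  have h1 := Complex.norm_exp_sub_one_sub_id_le (x := z) (by linarith)
  have h2 := norm_sub_norm_le z (z - (Complex.exp z - 1))
  rw [sub_sub_cancel, norm_sub_rev z] at h2
  nlinarith [norm_nonneg z]

/-- By continuity `|1 - e^{-νp}|` stays above half its value at `μ` on a small ball, which bounds
the resolvent kernels uniformly. -/
theorem mem_resolventSetStar_of_exp_ne_one (hX : IsSeqComplete X) (hT : IsSemigroup T)
    (hc : IsStronglyContinuous T) (he : IsLocallyEquicontinuous T) {p : ℝ≥0}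
    (hp : T p = ContinuousLinearMap.id ℂ X) {μ : ℂ} (hμ : Complex.exp (-μ * p) ≠ 1) :
    μ ∈ resolventSetStar (generator T) := by
  set η := ‖1 - Complex.exp (-μ * p)‖ with hη
  have hη0 : 0 < η := norm_pos_iff.2 (sub_ne_zero.2 hμ.symm)
  have hcont : Continuous fun ν : ℂ => ‖1 - Complex.exp (-ν * p)‖ := by fun_prop
  obtain ⟨δ, hδ, hd⟩ := Metric.eventually_nhds_iff.1
    (continuousAt_const.eventually_lt hcont.continuousAt (half_lt_self hη0))
  have hne : ∀ ν ∈ Metric.ball μ δ, Complex.exp (-ν * p) ≠ 1 := fun ν hν h => by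
    have := hd hν
    simp only [h, sub_self, norm_zero] at this
    linarith
  refine mem_resolventSetStar_of_kernel hX hc he (M := (η / 2)⁻¹ * Real.exp ((‖μ‖ + δ) * p)) hδ
    (b := p) (k := fun ν s => (1 - Complex.exp (-ν * p))⁻¹ * Complex.exp (-ν * s)) (fun ν => by fun_prop)
    (fun ν hν s hs => ?_) (fun ν hν h => ?_) fun ν hν x y hy => ?_
  · rw [norm_mul, norm_inv]
    refine mul_le_mul (inv_anti₀ (half_pos hη0) (hd hν).le)
      ((norm_exp_neg_mul_le hs).trans (Real.exp_le_exp.2 ?_)) (norm_nonneg _) (by positivity)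
    refine mul_le_mul_of_nonneg_right ?_ p.coe_nonneg
    have := norm_sub_norm_le ν μ
    have := mem_ball_iff_norm.1 hν
    linarith
  · refine hne ν hν ?_
    rw [neg_mul, Complex.exp_neg, exp_eq_one_of_mem_pointSpectrum hT hc hp h, inv_one]
  · exact hasGeneratorAt_weakIntegral_of_exp_ne_one hX hT hc hp (hne ν hν) hy

/-- The usual kernel has a pole at `μ`, but its singular part multiplies `∫₀ᵖ e^{-μs} T(s)x ds`,
which vanishes because `μ` is not an eigenvalue. -/
theorem mem_resolventSetStar_of_exp_eq_one (hX : IsSeqComplete X) (hT : IsSemigroup T)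
    (hc : IsStronglyContinuous T) (he : IsLocallyEquicontinuous T) {p : ℝ≥0} (hp0 : 0 < p)
    (hp : T p = ContinuousLinearMap.id ℂ X) {μ : ℂ} (hμ : Complex.exp (-μ * p) = 1)
    (hσ : μ ∉ pointSpectrum (generator T)) : μ ∈ resolventSetStar (generator T) := by
  have hp0' : (0 : ℝ) < p := hp0
  have hpc : ((p : ℝ) : ℂ) ≠ 0 := by exact_mod_cast hp0'.ne'
  have hker : ∀ x, HasWeakIntegral (fun s : ℝ => Complex.exp (-μ * s) • orbit T x s) p 0 := by
    intro x
    have hcx := continuous_orbit hc x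
    obtain ⟨y, hy⟩ := exists_hasWeakIntegral hX
      (f := fun s : ℝ => Complex.exp (-μ * s) • orbit T x s) (by fun_prop) p
    have hgen := hasGeneratorAt_weakIntegral_exp hX hT hc hp hy
    rw [hμ, sub_self, zero_smul, add_zero] at hgen
    by_cases hy0 : y = 0
    · exact hy0 ▸ hy
    · exact absurd (hgen.mem_pointSpectrum hy0) hσ
  have hsplit : ∀ (ν : ℂ) (s : ℝ),
      Complex.exp (-ν * s) = Complex.exp (-μ * s) * Complex.exp (-(ν - μ) * s) := fun ν s => by
    rw [← Complex.exp_add]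
    ring_nf
  have hsplit_p : ∀ ν : ℂ, Complex.exp (-ν * p) = Complex.exp (-(ν - μ) * p) := fun ν => by
    rw [hsplit, hμ, one_mul]
  -- The radius `1 / (2p)` keeps the exponent `(ν - μ)s` at most `1/2` in norm for `s ≤ p`, the
  -- range where `e^z - 1` is comparable to `z`.
  have hnorm : ∀ ν ∈ Metric.ball μ (1 / (2 * p)), ∀ s ∈ Set.Icc (0 : ℝ) p,
      ‖-(ν - μ) * (s : ℂ)‖ ≤ ‖ν - μ‖ * p ∧ ‖ν - μ‖ * p ≤ 1 / 2 := fun ν hν s hs => by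
    constructor
    · rw [norm_mul, norm_neg, Complex.norm_real, Real.norm_eq_abs, abs_of_nonneg hs.1]
      exact mul_le_mul_of_nonneg_left hs.2 (norm_nonneg _)
    · have h1 := (mem_ball_iff_norm.1 hν).le
      calc ‖ν - μ‖ * p ≤ 1 / (2 * p) * p := by gcongr
        _ = 1 / 2 := by field_simp
  have hlow : ∀ ν ∈ Metric.ball μ (1 / (2 * p)),
      ‖ν - μ‖ * p / 2 ≤ ‖1 - Complex.exp (-ν * p)‖ := fun ν hν => by
    have hn : ‖-(ν - μ) * ((p : ℝ) : ℂ)‖ = ‖ν - μ‖ * p := by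
      rw [norm_mul, norm_neg, Complex.norm_real, Real.norm_eq_abs, abs_of_pos hp0']
    rw [hsplit_p, norm_sub_rev 1, ← hn]
    exact half_norm_le_norm_exp_sub_one (hn ▸ (hnorm ν hν p ⟨hp0'.le, le_rfl⟩).2)
  have hne : ∀ ν ∈ Metric.ball μ (1 / (2 * p)), ν ≠ μ → Complex.exp (-ν * p) ≠ 1 :=
    fun ν hν hνμ h => by
      have h1 := hlow ν hν
      rw [h, sub_self, norm_zero] at h1
      have : 0 < ‖ν - μ‖ := norm_pos_iff.2 (sub_ne_zero.2 hνμ)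
      nlinarith
  -- The value at `ν = μ` is the limit of the other branch. Off `μ`, the numerator is at most `2|ν -
  -- μ|p · e^{|μ|p}` and the denominator at least `|ν - μ|p / 2`, whence the constant `4`.
  refine mem_resolventSetStar_of_kernel hX hc he (M := 4 * Real.exp (‖μ‖ * p))
    (δ := 1 / (2 * p)) (b := p) (by positivity)
    (k := fun ν s => if ν = μ then (-(p : ℂ))⁻¹ * (s * Complex.exp (-μ * s)) else
      (1 - Complex.exp (-ν * p))⁻¹ * (Complex.exp (-ν * s) - Complex.exp (-μ * s)))
    (fun ν => ?_) (fun ν hν s hs => ?_) (fun ν hν h => ?_) fun ν hν x y hy => ?_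
  · split_ifs <;> fun_prop
  · have hE := norm_exp_neg_mul_le (μ := μ) hs
    have hE0 := Real.exp_pos (‖μ‖ * p)
    split_ifs with hνμ
    · rw [norm_mul, norm_mul, norm_inv, norm_neg, Complex.norm_real, Complex.norm_real,
        Real.norm_eq_abs, Real.norm_eq_abs, abs_of_nonneg hs.1, abs_of_pos hp0', ← mul_assoc]
      have h1 : (p : ℝ)⁻¹ * s ≤ 1 := by
        rw [inv_mul_le_one₀ hp0']
        exact hs.2
      calc (p : ℝ)⁻¹ * s * ‖Complex.exp (-μ * s)‖ ≤ 1 * Real.exp (‖μ‖ * p) :=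
            mul_le_mul h1 hE (norm_nonneg _) zero_le_one
        _ ≤ 4 * Real.exp (‖μ‖ * p) := by linarith
    · obtain ⟨h1, h2⟩ := hnorm ν hν s hs
      have hpos : 0 < ‖ν - μ‖ * p :=
        mul_pos (norm_pos_iff.2 (sub_ne_zero.2 hνμ)) hp0'
      have h3 : ‖Complex.exp (-(ν - μ) * s) - 1‖ ≤ 2 * (‖ν - μ‖ * p) :=
        (Complex.norm_exp_sub_one_le (h1.trans (h2.trans (by norm_num)))).trans (by linarith)
      rw [hsplit ν s, ← mul_sub_one, norm_mul, norm_mul, norm_inv]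
      calc _ ≤ (‖ν - μ‖ * p / 2)⁻¹ * (Real.exp (‖μ‖ * p) * (2 * (‖ν - μ‖ * p))) :=
            mul_le_mul (inv_anti₀ (half_pos hpos) (hlow ν hν))
              (mul_le_mul hE h3 (norm_nonneg _) hE0.le) (by positivity) (by positivity)
        _ = 4 * Real.exp (‖μ‖ * p) := by
            rw [show (‖ν - μ‖ * p / 2)⁻¹ * (Real.exp (‖μ‖ * p) * (2 * (‖ν - μ‖ * p))) =
              4 * Real.exp (‖μ‖ * p) * ((‖ν - μ‖ * p)⁻¹ * (‖ν - μ‖ * p)) by rw [inv_div]; ring,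
              inv_mul_cancel₀ hpos.ne', mul_one]
  · by_cases hνμ : ν = μ
    · exact hσ (hνμ ▸ h)
    · refine hne ν hν hνμ ?_
      rw [neg_mul, Complex.exp_neg, exp_eq_one_of_mem_pointSpectrum hT hc hp h, inv_one]
  · have hcx := continuous_orbit hc x
    by_cases hνμ : ν = μ
    · subst hνμ
      simp only [if_true] at hy
      have h1 := hy.const_smul (-(p : ℂ))
      simp only [smul_smul, mul_inv_cancel_left₀ (neg_ne_zero.2 hpc)] at h1
      have h2 := (hasGeneratorAt_weakIntegral_mul_exp hX hT hc hp hμ (hker x) h1).smul (-(p : ℂ))⁻¹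
      rw [smul_add, smul_comm _ ν, smul_smul _ _ y, inv_mul_cancel₀ (neg_ne_zero.2 hpc),
        one_smul, smul_smul _ _ x, inv_neg, neg_mul, inv_mul_cancel₀ hpc, neg_smul, one_smul, ← sub_eq_add_neg] at h2
      exact h2
    · simp only [if_neg hνμ] at hy
      refine hasGeneratorAt_weakIntegral_of_exp_ne_one hX hT hc hp (hne ν hν hνμ) ?_
      -- Adding back the vanishing integral of `e^{-μs}` restores the standard resolvent kernel.
      have h1 := hy.add (by fun_prop) (by fun_prop)
        ((hker x).const_smul (1 - Complex.exp (-ν * p))⁻¹)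
      rw [smul_zero, add_zero] at h1
      convert! h1 using 2 with s
      rw [smul_smul, ← add_smul]
      ring_nf

theorem spectrumStar_eq_pointSpectrum (hX : IsSeqComplete X) (hT : IsSemigroup T)
    (hc : IsStronglyContinuous T) (he : IsLocallyEquicontinuous T) {p : ℝ≥0} (hp0 : 0 < p)
    (hp : T p = ContinuousLinearMap.id ℂ X) :
    spectrumStar (generator T) = pointSpectrum (generator T) := by
  ext μ
  refine ⟨fun h => ?_, fun h hρ => h hρ.1.1.1⟩
  by_contra hσ
  by_cases hμ : Complex.exp (-μ * p) = 1
  · exact h (mem_resolventSetStar_of_exp_eq_one hX hT hc he hp0 hp hμ hσ)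
  · exact h (mem_resolventSetStar_of_exp_ne_one hX hT hc he hp hμ)

end Periodic

end Spectrum

end LCSemigroup


theorem mainTheorem7 {X : Type*} [AddCommGroup X] [Module ℂ X] [UniformSpace X]
    [IsUniformAddGroup X] [ContinuousSMul ℂ X] [LocallyConvexSpace ℝ X] [T2Space X]
    (hX : LCSemigroup.IsSeqComplete X)
    (T : ℝ≥0 → X →L[ℂ] X) (hT : LCSemigroup.IsSemigroup T)
    (hT_cont : LCSemigroup.IsStronglyContinuous T)
    (hT_equi : LCSemigroup.IsLocallyEquicontinuous T) :
    LCSemigroup.IsPeriodic T ↔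
      LCSemigroup.spectrumStar (LCSemigroup.generator T) =
          LCSemigroup.pointSpectrum (LCSemigroup.generator T) ∧
        (∃ α : ℝ, 0 < α ∧ LCSemigroup.pointSpectrum (LCSemigroup.generator T) ⊆
          Set.range fun n : ℤ => 2 * (Real.pi : ℂ) * Complex.I * (α : ℂ) * (n : ℂ)) ∧
        (Nontrivial X → Dense
          (Submodule.span ℂ (LCSemigroup.eigenvectors (LCSemigroup.generator T)) : Set X)) := by
  have := LCSemigroup.polynormableSpace_complex (X := X)
  constructor
  · rintro ⟨p, hp0, hp⟩
    have hp0' : (0 : ℝ) < p := hp0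
    refine ⟨LCSemigroup.spectrumStar_eq_pointSpectrum hX hT hT_cont hT_equi hp0 hp,
      ⟨(p : ℝ)⁻¹, inv_pos.2 hp0', fun μ hμ => ?_⟩,
      fun _ => LCSemigroup.dense_span_eigenvectors hX hT hT_cont hp0 hp⟩
    obtain ⟨n, hn⟩ := Complex.exp_eq_one_iff.1
      (LCSemigroup.exp_eq_one_of_mem_pointSpectrum hT hT_cont hp hμ)
    have hpc : ((p : ℝ) : ℂ) ≠ 0 := by exact_mod_cast hp0'.ne'
    refine ⟨n, ?_⟩
    rw [← mul_left_inj' hpc, hn]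
    push_cast
    field_simp
  · rintro ⟨-, ⟨α, hα, hsub⟩, hd⟩
    rcases subsingleton_or_nontrivial X with hsing | hnt
    -- In the zero space every operator is the identity, so any positive time is a period.
    · exact ⟨1, one_pos, ContinuousLinearMap.ext fun x => Subsingleton.elim _ _⟩
    · exact LCSemigroup.isPeriodic_of_dense_eigenvectors hT hT_cont hα hsub (hd hnt)
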